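/- \textbf{Proposition (Linear vectorial equations up to the Klein bottle).} Let $\overline P$ be a Gauss code on $E=\{1,\dots,n\}$, i.e. a cyclic sequence of length $2n$ in which each element of $E$ occurs exactly twice. Work in the $\mathbb Z_2$-vector space $2^E$ (addition is symmetric difference), in which a label $\ell$ also denotes the singleton $\{\ell\}$. Let $i(x)\subseteq E$ be the set of labels that occur exactly once between the two occurrences of $x$ in $\overline P$, and extend $i$ linearly to $i:2^E\to 2^E$. Put $\mathcal O=\{x\in E: |i(x)| \text{ is odd}\}$ and $\mathcal E=E\setminus\mathcal O$. A \emph{$2$-face-coloured realization} of $\overline P$ in a closed surface $S$ is a closed curve $P'$ in $S$ with $n$ simple self-crossings, labelled by $E$ and met along $P'$ in the cyclic order $\overline P$, such that the induced $4$-regular graph is embedded in $S$ with open disks as faces, together with a proper $2$-colouring (primal/dual) of its faces. Each $x\in E$ is then an edge joining the two primal faces at opposite corners of the crossing $x$; call $x$ \emph{black} if the two passages of $P'$ through the crossing traverse this edge in the same direction, and \emph{white} otherwise. Let $\kappa(x)=\{x\}$ for black $x$ and $\kappa(x)=\emptyset$ for white $x$, extended linearly; let $c=\kappa+i$, let $\widetilde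 c=c+\mathrm{id}$ (the map $c$ with black and white interchanged), and $b=\widetilde c\circ c$. Suppose that $S$ is the sphere, the projective plane or the Klein bottle. Then: (1) There are partitions (with possibly empty parts) $\mathcal O=\mathcal O_0\sqcup\mathcal O_1$ and $\mathcal E=\mathcal E_0\sqcup\mathcal E_1$ such that $$b(x)=\begin{cases}\mathcal O_0\cup\mathcal E_1 & x\in\mathcal O_0,\\ \mathcal O_1\cup\mathcal E_1 & x\in\mathcal O_1,\\ \emptyset & x\in\mathcal E_0,\\ \mathcal O & x\in\mathcal E_1.\end{cases}\qquad(*)$$ If $S$ is the Klein bottle, they can be chosen so that moreover $\mathcal O_0\ne\emptyset$ and at most one of $\mathcal O_1,\mathcal E_1$ is empty. (2) For all partitions of $\mathcal O$ and $\mathcal E$ satisfying $(*)$, let $\gamma_k=1$ if $k$ is black and $\gamma_k=0$ if $k$ is white, and let $\delta_k=h$ if $k\in\mathcal O_h\cup\mathcal E_h$ ($h\in\{0,1\}$). Then $(\delta_1,\dots,\delta_n,\gamma_1,\dots,\gamma_n)$ is a solution over $\mathbb Z_2$ of the system of $n$ vectorial equations $$k\in\mathcal O\ \Rightarrow\ i^2(k)+\sum_{\ell\in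 i(k)}(1+\gamma_k+\gamma_\ell)\,\ell=\sum_{\ell\in\mathcal E}\delta_\ell\,\ell+\sum_{\ell\in\mathcal O}(1+\delta_k+\delta_\ell)\,\ell,$$ $$k\in\mathcal E\ \Rightarrow\ i^2(k)+\sum_{\ell\in i(k)}(1+\gamma_k+\gamma_\ell)\,\ell=\delta_k\sum_{\ell\in\mathcal O}\ell .$$ -/

import Mathlib

open scoped BigOperators

noncomputable section

/-! ### Gauss codes and their algebra over the field with two elements -/

/-- A Gauss code on the labels `E = Fin n`: a (cyclic) sequence of length `2n` in which each
label occurs exactly twice.  Position `t` is followed by `finRotate (2 * n) t`. -/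
structure GaussCode (n : ℕ) where
  seq : Fin (2 * n) → Fin n
  twice : ∀ x : Fin n, (Finset.univ.filter fun t => seq t = x).card = 2

/-- The subset `A` of `E` as a vector of the space `2^E`. -/
def subsetVec {n : ℕ} (A : Finset (Fin n)) : Fin n → ZMod 2 :=
  fun y => if y ∈ A then 1 else 0

/-- The vector `ℓ` of `2^E`, that is, the singleton `{ℓ}`. -/
def labelVec {n : ℕ} (l : Fin n) : Fin n → ZMod 2 := Pi.single l 1

/-- The linear map `2^E → 2^E` that extends a map given on the singletons. -/
def extendLinearly {n : ℕ} (f : Fin n → Finset (Fin n)) :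
    (Fin n → ZMod 2) →ₗ[ZMod 2] (Fin n → ZMod 2) :=
  Fintype.linearCombination (ZMod 2) fun x => subsetVec (f x)

namespace GaussCode

variable {n : ℕ} (P : GaussCode n)

open Classical in
/-- `i(x)`: the labels that occur exactly once between the two occurrences of `x`. -/
def interlace (x : Fin n) : Finset (Fin n) :=
  Finset.univ.filter fun y => ∃ s t : Fin (2 * n), s < t ∧ P.seq s = x ∧ P.seq t = x ∧
    ((Finset.Ioo s t).filter fun r => P.seq r = y).card = 1

/-- The linear map `i : 2^E → 2^E`. -/
def iMap : (Fin n → ZMod 2) →ₗ[ZMod 2] (Fin n → ZMod 2) :=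
  extendLinearly P.interlace

/-- The set `𝓞` of the labels `x` with `|i(x)|` odd. -/
def oddLabels : Finset (Fin n) := Finset.univ.filter fun x => Odd (P.interlace x).card

/-- The set `𝓔`, the complement of `𝓞`. -/
def evenLabels : Finset (Fin n) := (P.oddLabels)ᶜ

/-- The linear map `κ` with `κ(x) = {x}` for `x` in `B` and `κ(x) = ∅` for `x` not in `B`. -/
def kappa (B : Finset (Fin n)) : (Fin n → ZMod 2) →ₗ[ZMod 2] (Fin n → ZMod 2) :=
  extendLinearly fun x => if x ∈ B then {x} else ∅

/-- The linear map `c = κ + i` for the set `B` of black labels. -/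
def cMap (B : Finset (Fin n)) : (Fin n → ZMod 2) →ₗ[ZMod 2] (Fin n → ZMod 2) :=
  kappa B + P.iMap

/-- The linear map `b = c~ ∘ c`, where `c~` is the map `c` with black and white interchanged. -/
def bMap (B : Finset (Fin n)) : (Fin n → ZMod 2) →ₗ[ZMod 2] (Fin n → ZMod 2) :=
  (P.cMap Bᶜ).comp (P.cMap B)

/-- `(O₀, O₁)` is a partition of `𝓞` and `(E₀, E₁)` is a partition of `𝓔` (parts may be empty),
and these partitions give the values of `b` for the set `B` of black labels. -/
structure IsBPartition (B O₀ O₁ E₀ E₁ : Finset (Fin n)) : Prop where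
  odd_union : O₀ ∪ O₁ = P.oddLabels
  odd_disjoint : Disjoint O₀ O₁
  even_union : E₀ ∪ E₁ = P.evenLabels
  even_disjoint : Disjoint E₀ E₁
  of_mem_O₀ : ∀ x ∈ O₀, P.bMap B (labelVec x) = subsetVec (O₀ ∪ E₁)
  of_mem_O₁ : ∀ x ∈ O₁, P.bMap B (labelVec x) = subsetVec (O₁ ∪ E₁)
  of_mem_E₀ : ∀ x ∈ E₀, P.bMap B (labelVec x) = 0
  of_mem_E₁ : ∀ x ∈ E₁, P.bMap B (labelVec x) = subsetVec P.oddLabels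

/-- `(δ, γ)` solves the system of `n` vectorial equations of the code. -/
def IsSolution (δ γ : Fin n → ZMod 2) : Prop :=
  ∀ k : Fin n,
    (k ∈ P.oddLabels →
      P.iMap (P.iMap (labelVec k)) + ∑ l ∈ P.interlace k, (1 + γ k + γ l) • labelVec l =
        ∑ l ∈ P.evenLabels, δ l • labelVec l
          + ∑ l ∈ P.oddLabels, (1 + δ k + δ l) • labelVec l) ∧
    (k ∈ P.evenLabels →
      P.iMap (P.iMap (labelVec k)) + ∑ l ∈ P.interlace k, (1 + γ k + γ l) • labelVec l =
        δ k • ∑ l ∈ P.oddLabels, labelVec l)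

end GaussCode

/-! ### Graphs embedded in closed surfaces -/

/-- A connected graph embedded in a closed connected surface so that the faces are open disks,
encoded by its flags (the triangles of the barycentric subdivision, that is, the incident triples
vertex, edge, face, counted four for each edge).  The involution `chV` changes only the vertex of
a flag, `chE` only the edge and `chF` only the face. -/
structure CellularMap (F : Type*) where
  chV : Equiv.Perm F
  chE : Equiv.Perm F
  chF : Equiv.Perm F
  chV_chV : ∀ x, chV (chV x) = x
  chE_chE : ∀ x, chE (chE x) = x
  chF_chF : ∀ x, chF (chF x) = x
  chV_ne : ∀ x, chV x ≠ x
  chE_ne : ∀ x, chE x ≠ x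
  chF_ne : ∀ x, chF x ≠ x
  chV_chF : ∀ x, chV (chF x) = chF (chV x)
  chV_chF_ne : ∀ x, chV (chF x) ≠ x
  connected : MulAction.IsPretransitive (Subgroup.closure {chV, chE, chF}) F

namespace CellularMap

variable {F : Type*} (M : CellularMap F)

/-- Two flags belong to the same vertex. -/
def SameVertex (x y : F) : Prop := x ∈ MulAction.orbit (Subgroup.closure {M.chE, M.chF}) y

def numVertices : ℕ :=
  Nat.card (MulAction.orbitRel.Quotient (Subgroup.closure {M.chE, M.chF}) F)

def numEdges : ℕ :=
  Nat.card (MulAction.orbitRel.Quotient (Subgroup.closure {M.chV, M.chF}) F)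

def numFaces : ℕ :=
  Nat.card (MulAction.orbitRel.Quotient (Subgroup.closure {M.chV, M.chE}) F)

def eulerChar : ℤ := (M.numVertices : ℤ) - M.numEdges + M.numFaces

/-- The surface is orientable: the flags can be given two orientations so that adjacent flags
have opposite ones. -/
def Orientable : Prop :=
  ∃ o : F → Bool, ∀ x, o (M.chV x) = !o x ∧ o (M.chE x) = !o x ∧ o (M.chF x) = !o x

/-! The surface is named through the classification of closed connected surfaces. -/

def OnSphere : Prop := M.Orientable ∧ M.eulerChar = 2

def OnProjectivePlane : Prop := ¬ M.Orientable ∧ M.eulerChar = 1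

def OnKleinBottle : Prop := ¬ M.Orientable ∧ M.eulerChar = 0

/-- Every vertex has degree four: the rotation around a vertex, which carries a flag to the next
half-edge, returns for the first time after four steps. -/
def FourRegular : Prop := ∀ x, Function.minimalPeriod (fun y => M.chE (M.chF y)) x = 4

/-- In a 4-regular map, the flag on the opposite half-edge at the same vertex: the rotation by
two steps. -/
def opp (x : F) : F := M.chE (M.chF (M.chE (M.chF x)))

end CellularMap

/-! ### Lacets -/

/-- A 2-face-coloured lacet for the Gauss code `P`: a closed curve in a closed surface that forms
an embedded 4-regular graph, with a proper 2-colouring of the faces, whose crossings, labelled by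
`Fin n`, are met along the curve in the order `P`.

* `col` is the colouring; the faces of colour `true` are called primal.  The other faces are dual.
* A half-edge has exactly one flag on its primal side.  `enter t` is this flag for the half-edge
  along which the curve reaches its `t`-th crossing.  The curve leaves the crossing along the
  opposite half-edge and follows the edge to the next crossing.
* `once`: each half-edge is used exactly once, so the graph is formed by the curve alone and
  each edge is traversed once. -/
structure ColouredLacet {n : ℕ} (P : GaussCode n) (F : Type*) extends CellularMap F where
  fourRegular : toCellularMap.FourRegular
  col : F → Bool
  col_chV : ∀ x, col (chV x) = col x
  col_chE : ∀ x, col (chE x) = col x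
  col_chF : ∀ x, col (chF x) = !col x
  label : F → Fin n
  label_eq_iff : ∀ x y, label x = label y ↔ toCellularMap.SameVertex x y
  enter : Fin (2 * n) → F
  col_enter : ∀ t, col (enter t) = true
  label_enter : ∀ t, label (enter t) = P.seq t
  enter_next : ∀ t, enter (finRotate (2 * n) t) = chV (toCellularMap.opp (enter t))
  once : ∀ x, col x = true → ∃! t, x = enter t ∨ x = toCellularMap.opp (enter t)

namespace ColouredLacet

variable {n : ℕ} {P : GaussCode n} {F : Type*} (L : ColouredLacet P F)

open Classical in
/-- The set of black labels.  Label `k` is an edge of the graph whose vertices are the primal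
faces: it joins the two primal faces at opposite corners of the crossing `k`.  A passage of the
curve traverses this edge from the primal corner next to the half-edge of entry to the opposite
one.  The label is black if both passages traverse it in the same direction, that is, if the
two half-edges of entry bound the same primal corner. -/
def black : Finset (Fin n) :=
  Finset.univ.filter fun k => ∃ s t : Fin (2 * n), s ≠ t ∧ P.seq s = k ∧ P.seq t = k ∧
    L.chE (L.enter s) = L.enter t

/-- `γ k = 1` if `k` is black and `γ k = 0` if `k` is white. -/
def gamma : Fin n → ZMod 2 := fun k => if k ∈ L.black then 1 else 0

end ColouredLacet

/-- `δ k = 1` if `k` is in `O₁ ∪ E₁`, and `δ k = 0` otherwise. -/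
def deltaOf {n : ℕ} (O₁ E₁ : Finset (Fin n)) : Fin n → ZMod 2 :=
  fun k => if k ∈ O₁ ∪ E₁ then 1 else 0

end

/-! The rank of `b` is 2 − χ(S). As `c~ = c + id`, the kernel of `b` is the direct sum of the
kernels of `c` and `c~`. A vector killed by `c` integrates along the curve to a function on its
edges that is constant around each primal face, unique up to a constant; so the number of primal
faces is dim ker `c` + 1, and dually for `c~` (`numFaces_eq`). With n vertices and 2n edges, Euler's
formula gives the rank (`finrank_range_bMap_black`).

The matrix of `b` is symmetric, and its diagonal is the indicator of 𝓞 (`bMap_labelVec_self`). Over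
the field with two elements, a symmetric form of rank at most one is the square of its diagonal, and
one of rank two with nonzero diagonal is u⊗u + v⊗v. The values of (u, v) at a label sort the labels
into O₀, O₁, E₀, E₁ (`isBPartition_of_apply_eq`). On the Klein bottle the diagonal is nonzero, since
𝓞 = ∅ would make the surface orientable (`orientable_of_oddLabels_eq_empty`).

Part (2) is pure algebra: the left sides of the equations are the values of `b` on labels
(`bMap_labelVec`). -/

namespace GaussCode

variable {n : ℕ} (P : GaussCode n)

/-! ### Positions and interlacement in a Gauss code -/

theorem exists_positions (x : Fin n) :
    ∃ s t, s < t ∧ ∀ r, P.seq r = x ↔ r = s ∨ r = t := by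
  obtain ⟨s, t, hst, h⟩ := Finset.card_eq_two.1 (P.twice x)
  have h' : ∀ r, P.seq r = x ↔ r = s ∨ r = t := fun r => by
    simpa using (Finset.ext_iff.1 h) r
  rcases lt_or_gt_of_ne hst with h1 | h1
  · exact ⟨s, t, h1, h'⟩
  · exact ⟨t, s, h1, fun r => (h' r).trans or_comm⟩

theorem eq_or_eq_of_seq_eq {s t r : Fin (2 * n)} (hst : s ≠ t) (h : P.seq s = P.seq t)
    (hr : P.seq r = P.seq t) : r = s ∨ r = t := by
  obtain ⟨p, q, -, hpq⟩ := P.exists_positions (P.seq t)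
  have h1 := (hpq s).1 h
  have h2 := (hpq t).1 rfl
  have h3 := (hpq r).1 hr
  grind

theorem mem_interlace {s t : Fin (2 * n)} (hst : s < t) (h : P.seq s = P.seq t) (y : Fin n) :
    y ∈ P.interlace (P.seq t) ↔ ((Finset.Ioo s t).filter fun r => P.seq r = y).card = 1 := by
  simp only [interlace, Finset.mem_filter, Finset.mem_univ, true_and]
  constructor
  · rintro ⟨s', t', hlt, hs', ht', hc⟩
    have h1 := P.eq_or_eq_of_seq_eq hst.ne h hs'
    have h2 := P.eq_or_eq_of_seq_eq hst.ne h ht'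
    have : s' = s ∧ t' = t := by grind
    rwa [this.1, this.2] at hc
  · exact fun hc => ⟨s, t, hst, h, rfl, hc⟩

theorem mem_interlace_iff {x y : Fin n} {s t p q : Fin (2 * n)} (hst : s < t)
    (hx : ∀ r, P.seq r = x ↔ r = s ∨ r = t) (hpq : p < q)
    (hy : ∀ r, P.seq r = y ↔ r = p ∨ r = q) :
    y ∈ P.interlace x ↔ Xor (s < p ∧ p < t) (s < q ∧ q < t) := by
  have hs : P.seq s = x := (hx s).2 (Or.inl rfl)
  have ht : P.seq t = x := (hx t).2 (Or.inr rfl)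
  have : ((Finset.Ioo s t).filter fun r => P.seq r = y)
      = ({p, q} : Finset (Fin (2 * n))).filter fun r => s < r ∧ r < t := by
    ext r
    simp [hy r, and_comm]
  rw [← ht, P.mem_interlace hst (hs.trans ht.symm), this, Finset.filter_insert,
    Finset.filter_singleton]
  by_cases h1 : s < p ∧ p < t <;> by_cases h2 : s < q ∧ q < t <;>
    simp [h1, h2, Xor, hpq.ne]

/-- Interlacement is the crossing of two chords. The symmetry makes `i`, hence `c` and `b`,
self-adjoint. -/
theorem interlace_comm {x y : Fin n} : y ∈ P.interlace x ↔ x ∈ P.interlace y := by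
  obtain ⟨s, t, hst, hx⟩ := P.exists_positions x
  obtain ⟨p, q, hpq, hy⟩ := P.exists_positions y
  rw [P.mem_interlace_iff hst hx hpq hy, P.mem_interlace_iff hpq hy hst hx]
  by_cases hxy : x = y
  · subst hxy
    have h1 := (hx p).1 ((hy p).2 (Or.inl rfl))
    have h2 := (hx q).1 ((hy q).2 (Or.inr rfl))
    simp only [Xor]
    grind
  · have h1 : s ≠ p := fun h => hxy (((hx s).2 (Or.inl rfl)).symm.trans ((hy s).2 (Or.inl h)))
    have h2 : s ≠ q := fun h => hxy (((hx s).2 (Or.inl rfl)).symm.trans ((hy s).2 (Or.inr h)))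
    have h3 : t ≠ p := fun h => hxy (((hx t).2 (Or.inr rfl)).symm.trans ((hy t).2 (Or.inl h)))
    have h4 : t ≠ q := fun h => hxy (((hx t).2 (Or.inr rfl)).symm.trans ((hy t).2 (Or.inr h)))
    simp only [Xor]
    grind

theorem not_mem_interlace_self (x : Fin n) : x ∉ P.interlace x := by
  obtain ⟨s, t, hst, hx⟩ := P.exists_positions x
  rw [P.mem_interlace_iff hst hx hst hx]
  simp [Xor]

/-- Labels met twice between the two positions cancel modulo 2. -/
theorem sum_Ioo_seq {s t : Fin (2 * n)} (hst : s < t) (h : P.seq s = P.seq t)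
    (v : Fin n → ZMod 2) :
    ∑ r ∈ Finset.Ioo s t, v (P.seq r) = ∑ y ∈ P.interlace (P.seq t), v y := by
  rw [← Finset.sum_fiberwise (Finset.Ioo s t) P.seq, ← Finset.sum_ite_mem_eq (P.interlace (P.seq t))]
  refine Finset.sum_congr rfl fun y _ => ?_
  have h1 : ∑ r ∈ (Finset.Ioo s t).filter (fun r => P.seq r = y), v (P.seq r)
      = (((Finset.Ioo s t).filter fun r => P.seq r = y).card : ZMod 2) * v y := by
    rw [Finset.sum_congr rfl (g := fun _ => v y), Finset.sum_const, nsmul_eq_mul]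
    intro r hr
    rw [(Finset.mem_filter.1 hr).2]
  rw [h1]
  have h2 : ((Finset.Ioo s t).filter fun r => P.seq r = y).card ≤ 2 :=
    (Finset.card_le_card (Finset.filter_subset_filter _ (Finset.subset_univ _))).trans
      (P.twice y).le
  have h3 := P.mem_interlace hst h y
  by_cases hy : y ∈ P.interlace (P.seq t)
  · simp [hy, h3.1 hy]
  · have h4 := mt h3.2 hy
    have h5 : ((Finset.Ioo s t).filter fun r => P.seq r = y).card = 0 ∨
      ((Finset.Ioo s t).filter fun r => P.seq r = y).card = 2 := by omega
    rcases h5 with h5 | h5 <;> simp only [hy, if_false, h5]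
    · simp
    · rw [show ((2 : ℕ) : ZMod 2) = 0 from rfl, zero_mul]

theorem sum_seq (v : Fin n → ZMod 2) : ∑ r, v (P.seq r) = 0 := by
  rw [← Finset.sum_fiberwise Finset.univ P.seq]
  refine Finset.sum_eq_zero fun y _ => ?_
  rw [Finset.sum_congr rfl (g := fun _ => v y), Finset.sum_const, nsmul_eq_mul, P.twice,
    show ((2 : ℕ) : ZMod 2) = 0 from rfl, zero_mul]
  intro r hr
  rw [(Finset.mem_filter.1 hr).2]

/-- The constant vector in `sum_Ioo_seq` counts the positions in between. Thus a label is even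
exactly when its two positions have opposite parity, which is what orientability needs. -/
theorem card_interlace_add {s t : Fin (2 * n)} (hst : s < t) (h : P.seq s = P.seq t) :
    ((P.interlace (P.seq t)).card : ZMod 2) = (s : ℕ) + (t : ℕ) + 1 := by
  have h1 := P.sum_Ioo_seq hst h fun _ => 1
  simp only [Finset.sum_const, nsmul_eq_mul, mul_one, Fin.card_Ioo] at h1
  rw [← h1]
  have h2 : ∃ d, (t : ℕ) = s + d + 1 := Nat.exists_eq_add_of_lt hst
  obtain ⟨d, hd⟩ := h2
  have h3 : ∀ a b : ZMod 2, a = b + (b + a + 1) + 1 := by decide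
  rw [hd, show (s : ℕ) + d + 1 - s - 1 = d by omega, Nat.cast_add, Nat.cast_add, Nat.cast_one,
    ← h3]

theorem mem_oddLabels {x : Fin n} :
    x ∈ P.oddLabels ↔ ((P.interlace x).card : ZMod 2) = 1 := by
  simp [oddLabels, ZMod.natCast_eq_one_iff_odd]

theorem mem_evenLabels {x : Fin n} : x ∈ P.evenLabels ↔ x ∉ P.oddLabels := by
  simp [evenLabels]

end GaussCode

/-! ### The linear maps c and b -/

theorem extendLinearly_apply {n : ℕ} (f : Fin n → Finset (Fin n)) (v : Fin n → ZMod 2)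
    (y : Fin n) : extendLinearly f v y = ∑ x, if y ∈ f x then v x else 0 := by
  simp [extendLinearly, Fintype.linearCombination_apply, subsetVec]

namespace GaussCode

variable {n : ℕ} (P : GaussCode n)

theorem iMap_apply (v : Fin n → ZMod 2) (y : Fin n) :
    P.iMap v y = ∑ x ∈ P.interlace y, v x := by
  rw [iMap, extendLinearly_apply, ← Finset.sum_filter]
  exact Finset.sum_congr (by ext x; simp [P.interlace_comm (x := x)]) fun _ _ => rfl

theorem kappa_apply (B : Finset (Fin n)) (v : Fin n → ZMod 2) (y : Fin n) :
    kappa B v y = if y ∈ B then v y else 0 := by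
  rw [kappa, extendLinearly_apply, Finset.sum_eq_single y]
  · by_cases h : y ∈ B <;> simp [h]
  · intro x _ hx
    by_cases h : x ∈ B <;> simp [h, hx.symm]
  · simp

theorem cMap_apply (B : Finset (Fin n)) (v : Fin n → ZMod 2) (y : Fin n) :
    P.cMap B v y = (if y ∈ B then v y else 0) + ∑ x ∈ P.interlace y, v x := by
  simp [cMap, kappa_apply, iMap_apply]

theorem cMap_compl (B : Finset (Fin n)) (v : Fin n → ZMod 2) :
    P.cMap Bᶜ v = v + P.cMap B v := by
  ext y
  rw [Pi.add_apply, cMap_apply, cMap_apply]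
  by_cases h : y ∈ B <;> simp only [Finset.mem_compl, h] <;> simp
  grind

theorem bMap_apply (B : Finset (Fin n)) (v : Fin n → ZMod 2) :
    P.bMap B v = P.cMap B v + P.cMap B (P.cMap B v) := by
  rw [bMap, LinearMap.comp_apply, cMap_compl]

/-- The maps `c` and `c + id` are coprime polynomials in `c`, so the kernel of their product splits.
-/
theorem finrank_ker_bMap (B : Finset (Fin n)) :
    Module.finrank (ZMod 2) (LinearMap.ker (P.bMap B)) =
      Module.finrank (ZMod 2) (LinearMap.ker (P.cMap B)) +
      Module.finrank (ZMod 2) (LinearMap.ker (P.cMap Bᶜ)) := by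
  have hinf : LinearMap.ker (P.cMap B) ⊓ LinearMap.ker (P.cMap Bᶜ) = ⊥ := by
    refine (Submodule.eq_bot_iff _).2 fun v hv => ?_
    simp only [Submodule.mem_inf, LinearMap.mem_ker, cMap_compl] at hv
    simpa [hv.1] using hv.2
  have hsup : LinearMap.ker (P.cMap B) ⊔ LinearMap.ker (P.cMap Bᶜ) = LinearMap.ker (P.bMap B) := by
    apply le_antisymm
    · refine sup_le (fun v hv => ?_) (fun v hv => ?_)
      · simp only [LinearMap.mem_ker, bMap_apply] at hv ⊢
        simp [hv]
      · simp only [LinearMap.mem_ker, bMap_apply, cMap_compl] at hv ⊢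
        rw [← map_add, hv, map_zero]
    · intro v hv
      rw [LinearMap.mem_ker, bMap_apply] at hv
      -- In v = (v + c v) + c v, the map `c` kills the first term and `c~` the second, both because
      -- b v = 0.
      refine Submodule.mem_sup.2 ⟨v + P.cMap B v, ?_, P.cMap B v, ?_, ?_⟩
      · rwa [LinearMap.mem_ker, map_add]
      · rwa [LinearMap.mem_ker, cMap_compl]
      · ext y
        simp [add_assoc, CharTwo.add_self_eq_zero]
  have := Submodule.finrank_sup_add_finrank_inf_eq (LinearMap.ker (P.cMap B))
    (LinearMap.ker (P.cMap Bᶜ))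
  rwa [hinf, finrank_bot, add_zero, hsup] at this

theorem finrank_range_bMap (B : Finset (Fin n)) :
    Module.finrank (ZMod 2) (LinearMap.range (P.bMap B)) +
      (Module.finrank (ZMod 2) (LinearMap.ker (P.cMap B)) +
      Module.finrank (ZMod 2) (LinearMap.ker (P.cMap Bᶜ))) = n := by
  rw [← finrank_ker_bMap, LinearMap.finrank_range_add_finrank_ker, Module.finrank_fin_fun]

theorem cMap_dotProduct (B : Finset (Fin n)) (v w : Fin n → ZMod 2) :
    P.cMap B v ⬝ᵥ w = v ⬝ᵥ P.cMap B w := by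
  simp only [dotProduct, cMap_apply, add_mul, mul_add, Finset.sum_add_distrib,
    Finset.sum_mul, Finset.mul_sum]
  congr 1
  · exact Finset.sum_congr rfl fun x _ => by split_ifs <;> simp
  · rw [Finset.sum_comm' (t' := Finset.univ) (s' := fun x => P.interlace x)]
    intro x y
    simp [P.interlace_comm (x := x)]

theorem labelVec_dotProduct (x : Fin n) (v : Fin n → ZMod 2) : labelVec x ⬝ᵥ v = v x := by
  simp [labelVec]

theorem bMap_dotProduct (B : Finset (Fin n)) (v w : Fin n → ZMod 2) :
    P.bMap B v ⬝ᵥ w = v ⬝ᵥ P.bMap B w := by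
  simp only [bMap_apply, add_dotProduct, dotProduct_add, cMap_dotProduct]

theorem bMap_symm (B : Finset (Fin n)) (x y : Fin n) :
    P.bMap B (labelVec x) y = P.bMap B (labelVec y) x := by
  rw [← labelVec_dotProduct y (P.bMap B (labelVec x)), ← bMap_dotProduct, dotProduct_comm, labelVec_dotProduct]

/-- By self-adjointness the entry is ⟨x, c x⟩ + ⟨c x, c x⟩, and ⟨w, w⟩ is the sum of the entries of
w modulo 2. The two contributions of κ cancel, which leaves |i(x)|. -/
theorem bMap_labelVec_self (B : Finset (Fin n)) (x : Fin n) :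
    P.bMap B (labelVec x) x = if x ∈ P.oddLabels then 1 else 0 := by
  have h1 : P.bMap B (labelVec x) x = ((P.interlace x).card : ZMod 2) := by
    have hsq : ∀ a : ZMod 2, a * a = a := by decide
    have hi : ∀ y, P.cMap B (labelVec x) y =
        (if y = x ∧ x ∈ B then 1 else 0) + if y ∈ P.interlace x then 1 else 0 := by
      intro y
      rw [cMap_apply]
      congr 1
      · by_cases h : y = x
        · subst h; simp [labelVec]
        · simp [labelVec, h]
      · simp only [labelVec, Pi.single_apply, Finset.sum_ite_eq', P.interlace_comm (x := x)]
    rw [← labelVec_dotProduct x (P.bMap B (labelVec x)), bMap_apply, dotProduct_add,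
      labelVec_dotProduct, ← P.cMap_dotProduct B (labelVec x) (P.cMap B (labelVec x))]
    simp only [dotProduct, hsq]
    simp only [hi, Finset.sum_add_distrib, P.not_mem_interlace_self x, if_false, add_zero]
    by_cases h : x ∈ B <;> simp [h, ← add_assoc, CharTwo.add_self_eq_zero]
  rw [h1]
  split_ifs with h
  · exact P.mem_oddLabels.1 h
  · have h2 := mt P.mem_oddLabels.2 h
    have h3 : ∀ a : ZMod 2, a ≠ 1 → a = 0 := by decide
    exact h3 _ h2

end GaussCode

/-! ### Primitives along a cyclic sequence -/

theorem finRotate_val_of_lt {N : ℕ} (t : Fin N) (h : (t : ℕ) + 1 < N) :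
    (finRotate N t : ℕ) = t + 1 := by
  obtain _ | N := N
  · exact t.elim0
  · exact coe_finRotate_of_ne_last fun h' => by simp [h'] at h

theorem finRotate_val_of_eq {N : ℕ} (t : Fin N) (h : (t : ℕ) + 1 = N) :
    (finRotate N t : ℕ) = 0 := by
  obtain _ | N := N
  · exact t.elim0
  · have : t = Fin.last N := Fin.ext (by simpa using h)
    rw [this, finRotate_last, Fin.val_zero]

theorem eq_of_comp_finRotate_eq {N : ℕ} {α : Type*} {g : Fin N → α}
    (h : ∀ t, g (finRotate N t) = g t) (s t : Fin N) : g s = g t := by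
  have hN : 0 < N := s.pos
  have h0 : ∀ k (hk : k < N), g ⟨k, hk⟩ = g ⟨0, hN⟩ := by
    intro k
    induction k with
    | zero => exact fun _ => rfl
    | succ k ih =>
      intro hk
      rw [← ih (by omega), ← h ⟨k, by omega⟩]
      exact congrArg g (Fin.ext (finRotate_val_of_lt ⟨k, by omega⟩ hk).symm)
  exact (h0 s s.2).trans (h0 t t.2).symm

theorem exists_primitive_finRotate {N : ℕ} {A : Type*} [AddCommGroup A] (h : Fin N → A)
    (h0 : ∑ r, h r = 0) : ∃ g : Fin N → A, ∀ t, g (finRotate N t) = g t + h t := by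
  refine ⟨fun t => ∑ r ∈ Finset.Iio t, h r, fun t => ?_⟩
  have h1 : ∑ r ∈ Finset.Iio t, h r + h t = ∑ r ∈ Finset.Iic t, h r := by
    rw [← Finset.Iio_insert, Finset.sum_insert (by simp), add_comm]
  simp only [h1]
  rcases (Nat.succ_le_of_lt t.2).eq_or_lt with ht | ht
  -- At the last position the rotation wraps around to the empty partial sum, so the total must
  -- vanish.
  · rw [← Finset.sum_subset (Finset.subset_univ (Finset.Iic t))] at h0
    · rw [h0]
      refine Finset.sum_eq_zero fun r hr => ?_
      have h2 := finRotate_val_of_eq t ht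
      have h3 := Fin.lt_def.1 (Finset.mem_Iio.1 hr)
      omega
    · intro r _ hr
      have h3 : ¬ (r : ℕ) ≤ t := fun h => hr (Finset.mem_Iic.2 h)
      omega
  · refine Finset.sum_congr (Finset.ext fun r => ?_) fun _ _ => rfl
    have h2 := finRotate_val_of_lt t ht
    rw [Finset.mem_Iio, Finset.mem_Iic, Fin.lt_def, Fin.le_def]
    omega

theorem sum_Ioo_add_finRotate {N : ℕ} (g : Fin N → ZMod 2) {s t : Fin N} (hst : s < t) :
    ∑ r ∈ Finset.Ioo s t, (g r + g (finRotate N r)) = g (finRotate N s) + g t := by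
  obtain ⟨d, hd⟩ := Nat.exists_eq_add_of_lt hst
  induction d generalizing t with
  | zero =>
    have h1 : finRotate N s = t := Fin.ext (by rw [finRotate_val_of_lt s (by omega)]; omega)
    have h2 : Finset.Ioo s t = ∅ := Finset.eq_empty_of_forall_notMem fun r hr => by
      rw [Finset.mem_Ioo, Fin.lt_def, Fin.lt_def] at hr
      omega
    rw [h1, h2, Finset.sum_empty, CharTwo.add_self_eq_zero]
  | succ d ih =>
    have ht := t.2
    let t' : Fin N := ⟨s + d + 1, by omega⟩
    have h1 : finRotate N t' = t :=
      Fin.ext (by rw [finRotate_val_of_lt t' (by simp only [t']; omega)]; simp only [t']; omega)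
    have h2 : Finset.Ioo s t = insert t' (Finset.Ioo s t') := by
      ext r
      rw [Finset.mem_insert, Finset.mem_Ioo, Finset.mem_Ioo, Fin.lt_def, Fin.lt_def, Fin.lt_def,
        Fin.ext_iff]
      simp only [t']
      omega
    rw [h2, Finset.sum_insert (by simp), ih (by rw [Fin.lt_def]; simp only [t']; omega) rfl, h1]
    have h3 : ∀ a b c : ZMod 2, a + b + (c + a) = c + b := by decide
    exact h3 _ _ _

/-! ### The kernel of c and the potentials on the curve -/

namespace GaussCode

variable {n : ℕ} (P : GaussCode n)

/-- The functions on the edges of the curve (edge `t` ends at the crossing met at position `t`)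
that are constant around the faces on one side of the edges, where `B` is the set of the labels
whose two half-edges of entry bound the same of these faces. -/
def potentials (B : Finset (Fin n)) : Submodule (ZMod 2) (Fin (2 * n) → ZMod 2) where
  carrier := {g | ∀ s t, s ≠ t → P.seq s = P.seq t →
    (P.seq s ∈ B → g s = g t ∧ g (finRotate _ s) = g (finRotate _ t)) ∧
    (P.seq s ∉ B → g s = g (finRotate _ t))}
  zero_mem' := by simp
  add_mem' := by
    intro g h hg hh s t hst hseq
    refine ⟨fun hB => ?_, fun hB => ?_⟩
    · have h1 := (hg s t hst hseq).1 hB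
      have h2 := (hh s t hst hseq).1 hB
      simp only [Pi.add_apply, h1, h2, and_self]
    · have h1 := (hg s t hst hseq).2 hB
      have h2 := (hh s t hst hseq).2 hB
      simp only [Pi.add_apply, h1, h2]
  smul_mem' := by
    intro a g hg s t hst hseq
    refine ⟨fun hB => ?_, fun hB => ?_⟩
    · have h1 := (hg s t hst hseq).1 hB
      simp only [Pi.smul_apply, h1, and_self]
    · have h1 := (hg s t hst hseq).2 hB
      simp only [Pi.smul_apply, h1]

theorem seq_surjective : Function.Surjective P.seq := fun x => by
  obtain ⟨s, t, -, h⟩ := P.exists_positions x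
  exact ⟨s, (h s).2 (Or.inl rfl)⟩

/-- The labels at which a function on the edges of the curve changes. -/
noncomputable def coboundary : (Fin (2 * n) → ZMod 2) →ₗ[ZMod 2] (Fin n → ZMod 2) where
  toFun g x := g (Function.surjInv P.seq_surjective x) +
    g (finRotate _ (Function.surjInv P.seq_surjective x))
  map_add' g h := by
    ext x
    simp only [Pi.add_apply]
    exact add_add_add_comm _ _ _ _
  map_smul' a g := by
    ext x
    simp only [Pi.smul_apply, smul_eq_mul, RingHom.id_apply, mul_add]

/-- The definition of `coboundary` chooses one occurrence of each label. For a potential the choice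
is immaterial: the other passage has the same pair of end values, in the same order on `B` and
reversed off `B`. -/
theorem coboundary_apply {B : Finset (Fin n)} {g : Fin (2 * n) → ZMod 2}
    (hg : g ∈ P.potentials B) (t : Fin (2 * n)) :
    P.coboundary g (P.seq t) = g t + g (finRotate _ t) := by
  change g (Function.surjInv P.seq_surjective (P.seq t)) +
    g (finRotate _ (Function.surjInv P.seq_surjective (P.seq t))) = _
  have h1 : P.seq (Function.surjInv P.seq_surjective (P.seq t)) = P.seq t :=
    Function.surjInv_eq _ _
  generalize Function.surjInv P.seq_surjective (P.seq t) = s at h1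
  by_cases hst : s = t
  · rw [hst]
  · by_cases hB : P.seq s ∈ B
    · have h2 := (hg s t hst h1).1 hB
      rw [h2.1, h2.2]
    · have h2 := (hg s t hst h1).2 hB
      have h3 := (hg t s (Ne.symm hst) h1.symm).2 (h1 ▸ hB)
      rw [h2, h3, add_comm]

/-- The sum over interlaced labels telescopes along the arc from `s` to `t`; on `B`, the term from κ
moves its initial end back across the crossing. The vanishing of `c` thus becomes a face condition
on `g`. -/
theorem cMap_apply_seq (B : Finset (Fin n)) (v : Fin n → ZMod 2) (g : Fin (2 * n) → ZMod 2)
    (hg : ∀ t, v (P.seq t) = g t + g (finRotate _ t)) {s t : Fin (2 * n)} (hst : s < t)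
    (h : P.seq s = P.seq t) :
    P.cMap B v (P.seq t) =
      if P.seq t ∈ B then g s + g t else g (finRotate _ s) + g t := by
  rw [cMap_apply, ← P.sum_Ioo_seq hst h, Finset.sum_congr rfl fun r _ => hg r,
    sum_Ioo_add_finRotate g hst, ← h, hg s]
  split_ifs
  · have h3 : ∀ a b c : ZMod 2, a + b + (b + c) = a + c := by decide
    exact h3 _ _ _
  · exact zero_add _

/-- Every vector has a primitive along the closed curve, because each label is met twice. -/
theorem range_coboundary (B : Finset (Fin n)) :
    LinearMap.range (P.coboundary.domRestrict (P.potentials B)) = LinearMap.ker (P.cMap B) := by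
  apply le_antisymm
  · rintro _ ⟨⟨g, hg⟩, rfl⟩
    rw [LinearMap.domRestrict_apply, LinearMap.mem_ker]
    ext x
    obtain ⟨s, t, hst, hx⟩ := P.exists_positions x
    have hs : P.seq s = x := (hx s).2 (Or.inl rfl)
    have ht : P.seq t = x := (hx t).2 (Or.inr rfl)
    subst ht
    rw [P.cMap_apply_seq B _ g (P.coboundary_apply hg) hst hs]
    split_ifs with hB
    · rw [((hg s t hst.ne hs).1 (hs ▸ hB)).1, CharTwo.add_self_eq_zero, Pi.zero_apply]
    · rw [(hg t s hst.ne' hs.symm).2 hB, CharTwo.add_self_eq_zero, Pi.zero_apply]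
  · intro v hv
    obtain ⟨g, hg⟩ := exists_primitive_finRotate (fun t => v (P.seq t)) (P.sum_seq v)
    have h2 : ∀ a b : ZMod 2, a + (a + b) = b := by decide
    have hg' : ∀ t, v (P.seq t) = g t + g (finRotate _ t) := fun t => by rw [hg, h2]
    have hlt : ∀ s t, s < t → P.seq s = P.seq t →
        if P.seq t ∈ B then g s = g t ∧ g (finRotate _ s) = g (finRotate _ t)
        else g (finRotate _ s) = g t ∧ g s = g (finRotate _ t) := by
      intro s t hst h
      have h1 := P.cMap_apply_seq B v g hg' hst h
      rw [LinearMap.mem_ker.1 hv, Pi.zero_apply] at h1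
      -- The vanishing of `c` gives one equation at the crossing; the equality of `v` at both
      -- passages gives the other.
      have h3 := (hg' s).symm.trans ((congrArg v h).trans (hg' t))
      split_ifs with hB
      · rw [if_pos hB] at h1
        have h4 : g s = g t := CharTwo.add_eq_zero.1 h1.symm
        refine ⟨h4, ?_⟩
        rw [h4] at h3
        exact add_left_cancel h3
      · rw [if_neg hB] at h1
        have h4 : g (finRotate _ s) = g t := CharTwo.add_eq_zero.1 h1.symm
        refine ⟨h4, ?_⟩
        rw [h4, add_comm] at h3
        exact add_left_cancel h3
    have hmem : g ∈ P.potentials B := by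
      intro s t hst h
      rcases lt_or_gt_of_ne hst with h1 | h1
      · have h3 := hlt s t h1 h
        refine ⟨fun hB => ?_, fun hB => ?_⟩
        · rwa [if_pos (h ▸ hB)] at h3
        · rw [if_neg (h ▸ hB)] at h3
          exact h3.2
      · have h3 := hlt t s h1 h.symm
        refine ⟨fun hB => ?_, fun hB => ?_⟩
        · rw [if_pos hB] at h3
          exact ⟨h3.1.symm, h3.2.symm⟩
        · rw [if_neg hB] at h3
          exact h3.1.symm
    refine ⟨⟨g, hmem⟩, ?_⟩
    ext x
    obtain ⟨t, rfl⟩ := P.seq_surjective x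
    rw [LinearMap.domRestrict_apply, P.coboundary_apply hmem, hg']

/-- A potential with zero coboundary never changes along the single closed curve, so it is constant.
The hypothesis `0 < n` makes the constant one nonzero. -/
theorem finrank_potentials (hn : 0 < n) (B : Finset (Fin n)) :
    Module.finrank (ZMod 2) (P.potentials B) =
      Module.finrank (ZMod 2) (LinearMap.ker (P.cMap B)) + 1 := by
  rw [← range_coboundary, ← LinearMap.finrank_range_add_finrank_ker
    (P.coboundary.domRestrict (P.potentials B))]
  congr 1
  let t₀ : Fin (2 * n) := ⟨0, by omega⟩
  have h1 : (fun _ => 1 : Fin (2 * n) → ZMod 2) ∈ P.potentials B := by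
    intro s t _ _
    exact ⟨fun _ => ⟨rfl, rfl⟩, fun _ => rfl⟩
  have h2 : (⟨_, h1⟩ : P.potentials B) ∈
      LinearMap.ker (P.coboundary.domRestrict (P.potentials B)) := by
    rw [LinearMap.mem_ker, LinearMap.domRestrict_apply]
    ext x
    exact CharTwo.add_self_eq_zero (1 : ZMod 2)
  refine (finrank_eq_one_iff' (K := ZMod 2)
    (V := LinearMap.ker (P.coboundary.domRestrict (P.potentials B)))).2
    ⟨⟨⟨_, h1⟩, h2⟩, fun h => ?_, ?_⟩
  · have := congrFun (congrArg (fun w => w.1.1) h) t₀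
    exact one_ne_zero this
  · rintro ⟨⟨g, hg⟩, hk⟩
    refine ⟨g t₀, ?_⟩
    have h3 : ∀ t, g (finRotate _ t) = g t := fun t => by
      have h4 := P.coboundary_apply hg t
      rw [LinearMap.mem_ker, LinearMap.domRestrict_apply] at hk
      rw [hk] at h4
      exact (CharTwo.add_eq_zero.1 h4.symm).symm
    apply Subtype.ext
    apply Subtype.ext
    ext t
    change g t₀ * 1 = g t
    rw [mul_one, eq_of_comp_finRotate_eq h3]

end GaussCode

/-! ### Symmetric forms of small rank and the partitions -/

namespace GaussCode

variable {n : ℕ} (P : GaussCode n)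

/-- A symmetric form of rank at most one over the field with two elements is the square of its
diagonal. -/
theorem apply_eq_mul_of_finrank_range_le_one
    (f : (Fin n → ZMod 2) →ₗ[ZMod 2] (Fin n → ZMod 2))
    (hf : ∀ x y, f (labelVec x) y = f (labelVec y) x)
    (hr : Module.finrank (ZMod 2) (LinearMap.range f) ≤ 1) (x y : Fin n) :
    f (labelVec x) y = f (labelVec x) x * f (labelVec y) y := by
  obtain ⟨⟨w, hw⟩, h⟩ := finrank_le_one_iff.1 hr
  have h2 : ∀ z, ∃ a : ZMod 2, f (labelVec z) = a • w := fun z => by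
    obtain ⟨a, ha⟩ := h ⟨f (labelVec z), LinearMap.mem_range_self _ _⟩
    exact ⟨a, (congrArg Subtype.val ha).symm⟩
  obtain ⟨a, ha⟩ := h2 x
  obtain ⟨b, hb⟩ := h2 y
  have h3 := hf x y
  rw [ha, hb] at *
  simp only [Pi.smul_apply, smul_eq_mul] at *
  -- Both values are multiples of one vector `w`, so only four scalars remain to be checked.
  generalize w x = p at *
  generalize w y = q at *
  revert a b p q
  decide +revert

/-- A symmetric form of rank two over the field with two elements with a nonzero diagonal is a
sum of two squares. -/
theorem exists_apply_eq_of_finrank_range_eq_two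
    (f : (Fin n → ZMod 2) →ₗ[ZMod 2] (Fin n → ZMod 2))
    (hf : ∀ x y, f (labelVec x) y = f (labelVec y) x)
    (hr : Module.finrank (ZMod 2) (LinearMap.range f) = 2) (x : Fin n)
    (hx : f (labelVec x) x = 1) :
    ∃ u v : Fin n → ZMod 2, u x = 1 ∧ v x = 0 ∧ v ≠ 0 ∧
      ∀ y, f (labelVec y) = u y • u + v y • v := by
  set u := f (labelVec x) with hu
  -- Removing the square of `u` clears the coordinate `x` of every value. As `u x = 1`, the vector
  -- `u` leaves the range, and the rank drops to at most one.
  let g : (Fin n → ZMod 2) →ₗ[ZMod 2] (Fin n → ZMod 2) :=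
    f + (LinearMap.proj (R := ZMod 2) (φ := fun _ : Fin n => ZMod 2) x ∘ₗ f).smulRight u
  have hg : ∀ w, g w = f w + f w x • u := fun w => rfl
  have hg' : ∀ y, g (labelVec y) = f (labelVec y) + u y • u := fun y => by
    rw [hg, hu, hf y x]
  have h2 : ∀ a b : ZMod 2, a + b + b = a := by decide
  have hlt : LinearMap.range g < LinearMap.range f := by
    refine lt_of_le_of_ne ?_ fun h => ?_
    · rintro _ ⟨w, rfl⟩
      rw [hg, hu]
      exact add_mem (LinearMap.mem_range_self _ _)
        (Submodule.smul_mem _ _ (LinearMap.mem_range_self _ _))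
    · have : u ∈ LinearMap.range g := h ▸ LinearMap.mem_range_self f (labelVec x)
      obtain ⟨w, hw⟩ := this
      have h1 := congrFun hw x
      rw [hg, Pi.add_apply, Pi.smul_apply, smul_eq_mul, hx, mul_one,
        CharTwo.add_self_eq_zero] at h1
      exact zero_ne_one h1
  have hlt' := Submodule.finrank_lt_finrank_of_lt hlt
  have hgs := apply_eq_mul_of_finrank_range_le_one g (fun y z => by
    rw [hg', hg', Pi.add_apply, Pi.add_apply, hf, Pi.smul_apply, Pi.smul_apply, smul_eq_mul,
      smul_eq_mul, mul_comm]) (by omega)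
  have hfe : ∀ y, f (labelVec y) = u y • u + g (labelVec y) y • fun z => g (labelVec z) z := by
    intro y
    ext z
    simp only [Pi.add_apply, Pi.smul_apply, smul_eq_mul]
    rw [← hgs y z, hg', Pi.add_apply, Pi.smul_apply, smul_eq_mul, add_comm, h2]
  refine ⟨u, fun z => g (labelVec z) z, hx, ?_, fun h0 => ?_, hfe⟩
  · simp [hg', hx, ← hu, CharTwo.add_self_eq_zero]
  -- If the second vector were zero, the values of `f` would all be multiples of `u`.
  · have hle : LinearMap.range f ≤ Submodule.span (ZMod 2) {u} := by
      rintro _ ⟨w, rfl⟩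
      have hw : w = ∑ y, w y • (labelVec y : Fin n → ZMod 2) := by
        ext z
        simp [labelVec, Pi.single_apply]
      rw [hw, map_sum]
      refine sum_mem fun y _ => ?_
      rw [map_smul, hfe y, h0]
      simp only [smul_zero, add_zero]
      exact Submodule.smul_mem _ _ (Submodule.smul_mem _ _ (Submodule.mem_span_singleton_self _))
    have h4 := (Submodule.finrank_mono hle).trans (finrank_span_le_card ({u} : Set (Fin n → ZMod 2)))
    rw [Set.toFinset_singleton, Finset.card_singleton] at h4
    omega

/-- The diagonal is u + v, so a label is odd when exactly one of u, v is 1 there. Then u, v and u +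
v are the indicators of O₀ ∪ E₁, O₁ ∪ E₁ and 𝓞. -/
theorem isBPartition_of_apply_eq (B : Finset (Fin n)) (u v : Fin n → ZMod 2)
    (h : ∀ y, P.bMap B (labelVec y) = u y • u + v y • v) :
    P.IsBPartition B (Finset.univ.filter fun y => u y = 1 ∧ v y = 0)
      (Finset.univ.filter fun y => u y = 0 ∧ v y = 1)
      (Finset.univ.filter fun y => u y = 0 ∧ v y = 0)
      (Finset.univ.filter fun y => u y = 1 ∧ v y = 1) := by
  have ho : ∀ y, y ∈ P.oddLabels ↔ (u y = 1 ∧ v y = 0) ∨ (u y = 0 ∧ v y = 1) := by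
    intro y
    have h1 := P.bMap_labelVec_self B y
    rw [h] at h1
    simp only [Pi.add_apply, Pi.smul_apply, smul_eq_mul] at h1
    by_cases hy : y ∈ P.oddLabels <;> simp only [hy, if_true, if_false, true_iff, false_iff] at h1 ⊢
      <;> generalize u y = p at h1 ⊢ <;> generalize v y = q at h1 ⊢ <;> revert p q <;> decide
  have he : ∀ y, y ∈ P.evenLabels ↔ (u y = 0 ∧ v y = 0) ∨ (u y = 1 ∧ v y = 1) := by
    intro y
    rw [mem_evenLabels, ho]
    generalize u y = p
    generalize v y = q
    revert p q
    decide
  constructor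
  · ext y; simp [ho]
  · exact Finset.disjoint_filter.2 fun y _ h1 h2 => zero_ne_one (h2.1.symm.trans h1.1)
  · ext y; simp [he]
  · exact Finset.disjoint_filter.2 fun y _ h1 h2 => zero_ne_one (h1.1.symm.trans h2.1)
  all_goals
    intro x hx
    simp only [Finset.mem_filter, Finset.mem_univ, true_and] at hx
    rw [h, hx.1, hx.2]
    ext z
    simp only [Pi.add_apply, Pi.smul_apply, smul_eq_mul, subsetVec, Finset.mem_union,
      Finset.mem_filter, Finset.mem_univ, true_and, ho, Pi.zero_apply]
    generalize u z = p
    generalize v z = q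
    revert p q
    decide

theorem isBPartition_of_finrank_range_le_one (B : Finset (Fin n))
    (hr : Module.finrank (ZMod 2) (LinearMap.range (P.bMap B)) ≤ 1) :
    ∃ O₀ O₁ E₀ E₁ : Finset (Fin n), P.IsBPartition B O₀ O₁ E₀ E₁ := by
  -- Here u is the diagonal and v = 0, so O₁ and E₁ are empty.
  refine ⟨_, _, _, _, P.isBPartition_of_apply_eq B (fun y => P.bMap B (labelVec y) y) 0 fun y => ?_⟩
  ext z
  rw [apply_eq_mul_of_finrank_range_le_one _ (P.bMap_symm B) hr]
  simp

/-- An odd label serves as base point of the decomposition and lands in O₀, while v ≠ 0 says that O₁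
∪ E₁ is nonempty. -/
theorem isBPartition_of_finrank_range_eq_two (B : Finset (Fin n))
    (hr : Module.finrank (ZMod 2) (LinearMap.range (P.bMap B)) = 2)
    (hO : P.oddLabels.Nonempty) :
    ∃ O₀ O₁ E₀ E₁ : Finset (Fin n), P.IsBPartition B O₀ O₁ E₀ E₁ ∧
      O₀.Nonempty ∧ ¬ (O₁ = ∅ ∧ E₁ = ∅) := by
  obtain ⟨x, hx⟩ := hO
  obtain ⟨u, v, hux, hvx, hv, h⟩ := exists_apply_eq_of_finrank_range_eq_two _ (P.bMap_symm B) hr x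
    (by rw [bMap_labelVec_self, if_pos hx])
  refine ⟨_, _, _, _, P.isBPartition_of_apply_eq B u v h, ⟨x, by simp [hux, hvx]⟩, ?_⟩
  rintro ⟨h1, h2⟩
  refine hv (funext fun y => ?_)
  have h3 := Finset.filter_eq_empty_iff.1 h1 (Finset.mem_univ y)
  have h4 := Finset.filter_eq_empty_iff.1 h2 (Finset.mem_univ y)
  rw [Pi.zero_apply]
  generalize u y = p at h3 h4
  generalize v y = q at h3 h4
  revert p q
  decide

/-- Expand (κ + i + id)(κ + i): since κ² = κ, the terms κ² + κ cancel, and κi + iκ + i puts the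
coefficient 1 + γ k + γ l on each l in i(k). -/
theorem bMap_labelVec (B : Finset (Fin n)) (γ : Fin n → ZMod 2)
    (hγ : γ = fun k => if k ∈ B then 1 else 0) (k : Fin n) :
    P.bMap B (labelVec k) = P.iMap (P.iMap (labelVec k)) +
      ∑ l ∈ P.interlace k, (1 + γ k + γ l) • labelVec l := by
  have hk : kappa B (labelVec k) = γ k • labelVec k := by
    ext y
    by_cases h : y = k
    · subst h; simp [kappa_apply, hγ, labelVec]
    · simp [kappa_apply, labelVec, h]
  have hs : ∀ a : Fin n → ZMod 2, ∀ y, (∑ l ∈ P.interlace k, a l • labelVec l : Fin n → ZMod 2) y =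
      if y ∈ P.interlace k then a y else 0 := by
    intro a y
    simp [labelVec, Pi.single_apply]
  have hi : ∀ y, P.iMap (labelVec k) y = if y ∈ P.interlace k then 1 else 0 := by
    intro y
    simp [iMap_apply, labelVec, Pi.single_apply, P.interlace_comm (x := y)]
  rw [bMap_apply]
  simp only [cMap, LinearMap.add_apply, hk, map_add, map_smul]
  ext y
  simp only [Pi.add_apply, hs, Pi.smul_apply, kappa_apply, hi, smul_eq_mul]
  have hL : (labelVec k : Fin n → ZMod 2) y = if y = k then 1 else 0 := by
    simp [labelVec, Pi.single_apply]
  rw [hL]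
  generalize P.iMap (P.iMap (labelVec k)) y = w
  have h11 : ∀ a : ZMod 2, 1 + (1 + a) = a := by decide
  by_cases h1 : y = k
  · subst h1
    by_cases h3 : y ∈ B <;> simp [h3, P.not_mem_interlace_self, hγ, h11]
  · by_cases h3 : y ∈ B <;> by_cases h2 : y ∈ P.interlace k <;>
      by_cases h4 : k ∈ B <;>
      simp [h1, h2, h3, h4, hγ, h11, CharTwo.add_self_eq_zero, add_comm w 1, add_comm w]

/-- On 𝓞 the coefficient 1 + δ k + δ l selects the class of k, and on 𝓔 the coefficient δ l selects
E₁. No surface is involved. -/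
theorem IsBPartition.isSolution {B O₀ O₁ E₀ E₁ : Finset (Fin n)}
    (h : P.IsBPartition B O₀ O₁ E₀ E₁) (γ : Fin n → ZMod 2)
    (hγ : γ = fun k => if k ∈ B then 1 else 0) : P.IsSolution (deltaOf O₁ E₁) γ := by
  have hO : ∀ k, k ∈ P.oddLabels ↔ k ∈ O₀ ∨ k ∈ O₁ := fun k => by
    rw [← h.odd_union, Finset.mem_union]
  have hE : ∀ k, k ∈ P.evenLabels ↔ k ∈ E₀ ∨ k ∈ E₁ := fun k => by
    rw [← h.even_union, Finset.mem_union]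
  have hOd : ∀ k, k ∈ O₀ → k ∉ O₁ := fun k => fun hk => Finset.disjoint_left.1 h.odd_disjoint hk
  have hEd : ∀ k, k ∈ E₀ → k ∉ E₁ := fun k => fun hk => Finset.disjoint_left.1 h.even_disjoint hk
  have hOE : ∀ k, k ∈ P.evenLabels ↔ k ∉ P.oddLabels := fun k => P.mem_evenLabels
  have hs : ∀ (S : Finset (Fin n)) (a : Fin n → ZMod 2) (y : Fin n),
      (∑ l ∈ S, a l • labelVec l : Fin n → ZMod 2) y = if y ∈ S then a y else 0 := by
    intro S a y
    simp [labelVec, Pi.single_apply]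
  have hs' : (∑ l ∈ P.oddLabels, labelVec l : Fin n → ZMod 2) = subsetVec P.oddLabels := by
    ext y
    simp [labelVec, Pi.single_apply, subsetVec]
  intro k
  rw [← P.bMap_labelVec B γ hγ]
  refine ⟨fun hk => ?_, fun hk => ?_⟩
  · rcases (hO k).1 hk with h1 | h1
    · have hd : deltaOf O₁ E₁ k = 0 := by simp [deltaOf]; grind
      rw [h.of_mem_O₀ k h1]
      ext y
      rw [Pi.add_apply, hs, hs, hd]
      simp only [subsetVec, deltaOf, Finset.mem_union]
      have h2 : (1 : ZMod 2) + 1 = 0 := rfl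
      have hy1 := hO y
      have hy2 := hE y
      have hy3 := hOE y
      have hy4 := hOd y
      have hy5 := hEd y
      by_cases y0 : y ∈ O₀ <;> by_cases y1 : y ∈ O₁ <;> by_cases y2 : y ∈ E₀ <;>
        by_cases y3 : y ∈ E₁ <;> simp_all
    · have hd : deltaOf O₁ E₁ k = 1 := by simp [deltaOf, h1]
      rw [h.of_mem_O₁ k h1]
      ext y
      rw [Pi.add_apply, hs, hs, hd]
      simp only [subsetVec, deltaOf, Finset.mem_union]
      have h2 : (1 : ZMod 2) + 1 = 0 := rfl
      have hy1 := hO y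
      have hy2 := hE y
      have hy3 := hOE y
      have hy4 := hOd y
      have hy5 := hEd y
      by_cases y0 : y ∈ O₀ <;> by_cases y1 : y ∈ O₁ <;> by_cases y2 : y ∈ E₀ <;>
        by_cases y3 : y ∈ E₁ <;> simp_all
  · rw [hs']
    rcases (hE k).1 hk with h1 | h1
    · have hd : deltaOf O₁ E₁ k = 0 := by simp [deltaOf]; grind
      rw [h.of_mem_E₀ k h1, hd, zero_smul]
    · have hd : deltaOf O₁ E₁ k = 1 := by simp [deltaOf, h1]
      rw [h.of_mem_E₁ k h1, hd, one_smul]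

end GaussCode

/-! ### Flags at a crossing of the lacet -/

theorem apply_eq_of_mem_orbit_closure {F α : Type*} {S : Set (Equiv.Perm F)} {f : F → α}
    (h : ∀ s ∈ S, ∀ x, f (s x) = f x) {x y : F}
    (hxy : x ∈ MulAction.orbit (Subgroup.closure S) y) : f x = f y := by
  obtain ⟨⟨g, hg⟩, rfl⟩ := hxy
  change f (g y) = f y
  induction hg using Subgroup.closure_induction generalizing y with
  | mem s hs => exact h s hs y
  | one => rfl
  | mul a b _ _ ha hb => exact (ha (y := b y)).trans hb
  | inv a _ ha =>
    have := ha (y := a⁻¹ y)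
    rw [← Equiv.Perm.mul_apply, mul_inv_cancel] at this
    exact this.symm

theorem orbitRel_mk_apply {F : Type*} {S : Set (Equiv.Perm F)} {s : Equiv.Perm F} (hs : s ∈ S)
    (x : F) : (Quotient.mk'' (s x) : MulAction.orbitRel.Quotient (Subgroup.closure S) F) =
      Quotient.mk'' x :=
  Quotient.sound' ⟨⟨s, Subgroup.subset_closure hs⟩, rfl⟩

namespace ColouredLacet

variable {n : ℕ} {P : GaussCode n} {F : Type*} (L : ColouredLacet P F)

theorem label_chE (x : F) : L.label (L.chE x) = L.label x :=
  (L.label_eq_iff _ _).2 ⟨⟨L.chE, Subgroup.subset_closure (by simp)⟩, rfl⟩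

theorem label_chF (x : F) : L.label (L.chF x) = L.label x :=
  (L.label_eq_iff _ _).2 ⟨⟨L.chF, Subgroup.subset_closure (by simp)⟩, rfl⟩

theorem label_opp (x : F) : L.label (L.opp x) = L.label x := by
  simp only [CellularMap.opp, label_chE, label_chF]

theorem col_opp (x : F) : L.col (L.opp x) = L.col x := by
  simp only [CellularMap.opp, L.col_chE, L.col_chF, Bool.not_not]

theorem opp_opp (x : F) : L.opp (L.opp x) = x := by
  have h := Function.iterate_minimalPeriod (f := fun y => L.chE (L.chF y)) (x := x)
  rw [L.fourRegular x] at h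
  exact h

theorem opp_ne (x : F) : L.opp x ≠ x := by
  intro h
  have h1 : Function.IsPeriodicPt (fun y => L.chE (L.chF y)) 2 x := h
  have h2 := h1.minimalPeriod_le (by norm_num)
  rw [L.fourRegular x] at h2
  omega

/-- This turns a corner on the dual side into a corner on the primal side, where `once` and `enter`
apply. -/
theorem chE_chF (x : F) : L.chE (L.chF x) = L.chF (L.chE (L.opp x)) := by
  simp only [CellularMap.opp, L.chE_chE, L.chF_chF]

/-- The half-turn is central in the dihedral action on the flags of a vertex. -/
theorem opp_chE (x : F) : L.opp (L.chE x) = L.chE (L.opp x) := by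
  have h1 : L.opp (L.chE (L.opp x)) = L.chE x := by
    simp only [CellularMap.opp, L.chE_chE, L.chF_chF]
  rw [← h1, opp_opp]

theorem chE_ne_opp (x : F) : L.chE x ≠ L.opp x := by
  intro h
  have h1 : L.chE (L.chF x) = L.chF x := by rw [chE_chF, ← h, L.chE_chE]
  exact L.chE_ne _ h1

theorem enter_injective : Function.Injective L.enter := fun s _ h =>
  (L.once (L.enter s) (L.col_enter s)).unique (Or.inl rfl) (Or.inl h)

theorem enter_ne_opp (s t : Fin (2 * n)) : L.enter s ≠ L.opp (L.enter t) := by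
  intro h
  have h1 := (L.once (L.enter s) (L.col_enter s)).unique (Or.inl rfl) (Or.inr h)
  subst h1
  exact L.opp_ne _ h.symm

theorem chV_enter (t : Fin (2 * n)) :
    L.chV (L.enter (finRotate _ t)) = L.opp (L.enter t) := by
  rw [L.enter_next, L.chV_chV]

/-- The two half-edges of one passage are opposite, so a primal corner is bounded by half-edges of
different passages. The alternatives are entry (black) and exit (white). -/
theorem chE_enter {s t : Fin (2 * n)} (hst : s ≠ t) (h : P.seq s = P.seq t) :
    L.chE (L.enter s) = L.enter t ∨ L.chE (L.enter s) = L.opp (L.enter t) := by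
  obtain ⟨r, hr, -⟩ := L.once (L.chE (L.enter s)) (by rw [L.col_chE, L.col_enter])
  have h1 : P.seq r = P.seq t := by
    have h2 := L.label_chE (L.enter s)
    rw [L.label_enter] at h2
    rw [← h, ← h2]
    rcases hr with hr | hr
    · rw [hr, L.label_enter]
    · rw [hr, label_opp, L.label_enter]
  rcases P.eq_or_eq_of_seq_eq hst h h1 with rfl | rfl
  · rcases hr with hr | hr
    · exact (L.chE_ne _ hr).elim
    · exact (L.chE_ne_opp _ hr).elim
  · exact hr

theorem seq_mem_black {s t : Fin (2 * n)} (hst : s ≠ t) (h : P.seq s = P.seq t) :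
    P.seq s ∈ L.black ↔ L.chE (L.enter s) = L.enter t := by
  simp only [black, Finset.mem_filter, Finset.mem_univ, true_and]
  constructor
  · rintro ⟨p, q, hpq, hp, hq, hE⟩
    have h1 := P.eq_or_eq_of_seq_eq hst h (hp.trans h)
    have h2 := P.eq_or_eq_of_seq_eq hst h (hq.trans h)
    rcases h1 with rfl | rfl <;> rcases h2 with rfl | rfl
    · exact (hpq rfl).elim
    · exact hE
    · rw [← hE, L.chE_chE]
    · exact (hpq rfl).elim
  · exact fun hE => ⟨s, t, hst, rfl, h.symm, hE⟩

theorem chE_enter_of_not_mem_black {s t : Fin (2 * n)} (hst : s ≠ t) (h : P.seq s = P.seq t)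
    (hB : P.seq s ∉ L.black) : L.chE (L.enter s) = L.opp (L.enter t) :=
  (L.chE_enter hst h).resolve_left (mt (L.seq_mem_black hst h).2 hB)

/-! ### Edges of the lacet and constancy around corners -/

/-- The flag `x` lies on the edge along which the curve reaches its `t`-th crossing. -/
def OnEdge (x : F) (t : Fin (2 * n)) : Prop :=
  (x = L.enter t ∨ x = L.chV (L.enter t)) ∨ (L.chF x = L.enter t ∨ L.chF x = L.chV (L.enter t))

theorem exists_eq_enter_or_chV {x : F} (hx : L.col x = true) :
    ∃ t, x = L.enter t ∨ x = L.chV (L.enter t) := by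
  obtain ⟨t, ht | ht, -⟩ := L.once x hx
  · exact ⟨t, Or.inl ht⟩
  · exact ⟨finRotate _ t, Or.inr (by rw [chV_enter, ht])⟩

theorem exists_onEdge (x : F) : ∃ t, L.OnEdge x t := by
  by_cases hx : L.col x = true
  · obtain ⟨t, ht⟩ := L.exists_eq_enter_or_chV hx
    exact ⟨t, Or.inl ht⟩
  · obtain ⟨t, ht⟩ := L.exists_eq_enter_or_chV (x := L.chF x) (by simpa [L.col_chF] using hx)
    exact ⟨t, Or.inr ht⟩

theorem enter_or_chV_unique {x : F} {s t : Fin (2 * n)}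
    (hs : x = L.enter s ∨ x = L.chV (L.enter s)) (ht : x = L.enter t ∨ x = L.chV (L.enter t)) :
    s = t := by
  have key : ∀ s t, L.enter s ≠ L.chV (L.enter t) := fun s t => by
    obtain ⟨r, rfl⟩ := (finRotate (2 * n)).surjective t
    rw [chV_enter]
    exact L.enter_ne_opp s r
  rcases hs with rfl | rfl <;> rcases ht with ht | ht
  · exact L.enter_injective ht
  · exact (key _ _ ht).elim
  · exact (key _ _ ht.symm).elim
  · exact L.enter_injective (L.chV.injective ht)

theorem OnEdge.unique {x : F} {s t : Fin (2 * n)} (hs : L.OnEdge x s) (ht : L.OnEdge x t) :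
    s = t := by
  have hcol : ∀ (y : F) (r : Fin (2 * n)), y = L.enter r ∨ y = L.chV (L.enter r) →
      L.col y = true := by
    rintro y r (rfl | rfl)
    · exact L.col_enter r
    · rw [L.col_chV, L.col_enter]
  rcases hs with hs | hs <;> rcases ht with ht | ht
  · exact L.enter_or_chV_unique hs ht
  · have h1 := hcol _ _ ht
    rw [L.col_chF, hcol _ _ hs] at h1
    exact absurd h1 (by simp)
  · have h1 := hcol _ _ hs
    rw [L.col_chF, hcol _ _ ht] at h1
    exact absurd h1 (by simp)
  · exact L.enter_or_chV_unique hs ht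

/-- The edge of a flag, given by the position of the crossing to which it leads. -/
noncomputable def edge (x : F) : Fin (2 * n) := (L.exists_onEdge x).choose

theorem onEdge_edge (x : F) : L.OnEdge x (L.edge x) := (L.exists_onEdge x).choose_spec

theorem edge_enter (t : Fin (2 * n)) : L.edge (L.enter t) = t :=
  OnEdge.unique L (L.onEdge_edge _) (Or.inl (Or.inl rfl))

theorem edge_chV (x : F) : L.edge (L.chV x) = L.edge x := by
  refine OnEdge.unique L (L.onEdge_edge _) ?_
  have h : ∀ y t, y = L.enter t ∨ y = L.chV (L.enter t) →
      L.chV y = L.enter t ∨ L.chV y = L.chV (L.enter t) := by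
    rintro y t (rfl | rfl)
    · exact Or.inr rfl
    · exact Or.inl (L.chV_chV _)
  rcases L.onEdge_edge x with hx | hx
  · exact Or.inl (h _ _ hx)
  · refine Or.inr ?_
    rw [← L.chV_chF]
    exact h _ _ hx

theorem edge_chF (x : F) : L.edge (L.chF x) = L.edge x := by
  refine OnEdge.unique L (L.onEdge_edge _) ?_
  rcases L.onEdge_edge x with hx | hx
  · refine Or.inr ?_
    rwa [L.chF_chF]
  · exact Or.inl hx

theorem edge_opp_enter (t : Fin (2 * n)) : L.edge (L.opp (L.enter t)) = finRotate _ t := by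
  rw [← chV_enter, edge_chV, edge_enter]

theorem exists_twin (s : Fin (2 * n)) : ∃ t, s ≠ t ∧ P.seq s = P.seq t := by
  obtain ⟨p, q, hpq, h⟩ := P.exists_positions (P.seq s)
  rcases (h s).1 rfl with rfl | rfl
  · exact ⟨q, hpq.ne, ((h q).2 (Or.inr rfl)).symm⟩
  · exact ⟨p, hpq.ne', ((h p).2 (Or.inl rfl)).symm⟩

theorem apply_edge_chE_of_col {g : Fin (2 * n) → ZMod 2} (hg : g ∈ P.potentials L.black) {x : F}
    (hx : L.col x = true) : g (L.edge (L.chE x)) = g (L.edge x) := by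
  obtain ⟨s, hs, -⟩ := L.once x hx
  obtain ⟨t, hst, h⟩ := exists_twin (P := P) s
  by_cases hB : P.seq s ∈ L.black
  · have h1 := (L.seq_mem_black hst h).1 hB
    have h2 := (hg s t hst h).1 hB
    rcases hs with rfl | rfl
    · rw [h1, edge_enter, edge_enter, h2.1]
    · rw [← opp_chE, h1, edge_opp_enter, edge_opp_enter, h2.2]
  · have h1 := L.chE_enter_of_not_mem_black hst h hB
    have h2 := (hg s t hst h).2 hB
    have h3 := (hg t s hst.symm h.symm).2 (h ▸ hB)
    rcases hs with rfl | rfl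
    · rw [h1, edge_opp_enter, edge_enter, h2]
    · rw [← opp_chE, h1, opp_opp, edge_opp_enter, edge_enter, h3]

/-- A neighbouring dual corner is obtained by replacing one half-edge by its opposite, so entry and
exit are exchanged: black and white swap roles. -/
theorem apply_edge_chE_of_not_col {g : Fin (2 * n) → ZMod 2} (hg : g ∈ P.potentials L.blackᶜ)
    {x : F} (hx : L.col x = false) : g (L.edge (L.chE x)) = g (L.edge x) := by
  obtain ⟨s, hs, -⟩ := L.once (L.chF x) (by rw [L.col_chF, hx]; rfl)
  obtain ⟨t, hst, h⟩ := exists_twin (P := P) s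
  have hx' : L.edge (L.chE x) = L.edge (L.chE (L.opp (L.chF x))) := by
    rw [← edge_chF L (L.chE (L.opp (L.chF x))), ← chE_chF, L.chF_chF]
  rw [hx', ← edge_chF L x]
  by_cases hB : P.seq s ∈ L.black
  · have h1 := (L.seq_mem_black hst h).1 hB
    have h2 := (hg s t hst h).2 (by simpa using hB)
    have h3 := (hg t s hst.symm h.symm).2 (by simpa [h] using hB)
    rcases hs with hs | hs <;> rw [hs]
    · rw [← opp_chE, h1, edge_opp_enter, edge_enter, h2]
    · rw [opp_opp, h1, edge_opp_enter, edge_enter, h3]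
  · have h1 := L.chE_enter_of_not_mem_black hst h hB
    have h2 := (hg s t hst h).1 (by simpa using hB)
    rcases hs with hs | hs <;> rw [hs]
    · rw [← opp_chE, h1, opp_opp, edge_enter, edge_enter, h2.1]
    · rw [opp_opp, h1, edge_opp_enter, edge_opp_enter, h2.2]

/-! ### Faces as potentials and the Euler characteristic -/

/-- The faces of the lacet. -/
abbrev Face : Type _ :=
  MulAction.orbitRel.Quotient (Subgroup.closure {L.chV, L.chE}) F

/-- The face of a flag. -/
def face (x : F) : L.Face := Quotient.mk'' x

theorem face_chV (x : F) : L.face (L.chV x) = L.face x :=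
  orbitRel_mk_apply (Set.mem_insert _ _) x

theorem face_chE (x : F) : L.face (L.chE x) = L.face x :=
  orbitRel_mk_apply (Set.mem_insert_of_mem _ (Set.mem_singleton _)) x

theorem face_enter_finRotate (t : Fin (2 * n)) :
    L.face (L.enter (finRotate _ t)) = L.face (L.opp (L.enter t)) := by
  rw [L.enter_next, face_chV]

theorem face_chF_enter_finRotate (t : Fin (2 * n)) :
    L.face (L.chF (L.enter (finRotate _ t))) = L.face (L.chF (L.opp (L.enter t))) := by
  rw [L.enter_next, ← L.chV_chF, face_chV]

theorem face_chF (x : F) : L.face (L.chF x) = L.face (L.chF (L.opp (L.chE x))) := by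
  rw [← face_chE L (L.chF x), chE_chF, opp_chE]

theorem primal_mem_potentials (ψ : L.Face → ZMod 2) :
    (fun t => ψ (L.face (L.enter t))) ∈ P.potentials L.black := by
  intro s t hst h
  refine ⟨fun hB => ?_, fun hB => ?_⟩
  · have h1 := (L.seq_mem_black hst h).1 hB
    dsimp only
    rw [face_enter_finRotate, face_enter_finRotate, ← h1, face_chE, opp_chE, face_chE]
    exact ⟨rfl, rfl⟩
  · have h1 := L.chE_enter_of_not_mem_black hst h hB
    dsimp only
    rw [face_enter_finRotate, ← h1, face_chE]

theorem dual_mem_potentials (ψ : L.Face → ZMod 2) :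
    (fun t => ψ (L.face (L.chF (L.enter t)))) ∈ P.potentials L.blackᶜ := by
  intro s t hst h
  refine ⟨fun hB => ?_, fun hB => ?_⟩
  · have h1 := L.chE_enter_of_not_mem_black hst h (by simpa using hB)
    dsimp only
    rw [face_chF_enter_finRotate, face_chF_enter_finRotate, face_chF L (L.enter s),
      face_chF L (L.opp (L.enter s)), ← opp_chE, opp_opp, h1, opp_opp]
    exact ⟨rfl, rfl⟩
  · have h1 := (L.seq_mem_black hst h).1 (by simpa using hB)
    dsimp only
    rw [face_chF_enter_finRotate, face_chF, h1]

/-- A function on the faces as a pair of functions on the edges of the curve: the values on the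
primal sides and the values on the dual sides. -/
def faceFunctionToPotentials :
    (L.Face → ZMod 2) →ₗ[ZMod 2] P.potentials L.black × P.potentials L.blackᶜ where
  toFun ψ := (⟨_, L.primal_mem_potentials ψ⟩, ⟨_, L.dual_mem_potentials ψ⟩)
  map_add' _ _ := rfl
  map_smul' _ _ := rfl

/-- Each face meets an edge of the curve from its primal or its dual side, which gives injectivity.
Conversely, two potentials define a function on flags, and the corner lemmas make it constant on
faces. -/
theorem faceFunctionToPotentials_bijective : Function.Bijective L.faceFunctionToPotentials := by
  constructor
  · intro ψ φ h
    have h1 : ∀ t, ψ (L.face (L.enter t)) = φ (L.face (L.enter t)) := fun t =>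
      congrFun (congrArg (fun p => p.1.1) h) t
    have h2 : ∀ t, ψ (L.face (L.chF (L.enter t))) = φ (L.face (L.chF (L.enter t))) := fun t =>
      congrFun (congrArg (fun p => p.2.1) h) t
    ext c
    obtain ⟨x, rfl⟩ := Quotient.mk''_surjective c
    change ψ (L.face x) = φ (L.face x)
    rcases L.onEdge_edge x with (hx | hx) | (hx | hx)
    · rw [hx, h1]
    · rw [hx, face_chV, h1]
    · rw [← L.chF_chF x, hx, h2]
    · rw [← L.chF_chF x, hx, ← L.chV_chF, face_chV, h2]
  · rintro ⟨⟨g, hg⟩, ⟨g', hg'⟩⟩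
    let ψ₀ : F → ZMod 2 := fun x => if L.col x then g (L.edge x) else g' (L.edge x)
    have hψ : ∀ s ∈ ({L.chV, L.chE} : Set (Equiv.Perm F)), ∀ x, ψ₀ (s x) = ψ₀ x := by
      rintro s (rfl | rfl) x
      · simp only [ψ₀, L.col_chV, edge_chV]
      · simp only [ψ₀, L.col_chE]
        by_cases hx : L.col x = true
        · rw [if_pos hx, if_pos hx, L.apply_edge_chE_of_col hg hx]
        · rw [if_neg hx, if_neg hx, L.apply_edge_chE_of_not_col hg' (by simpa using hx)]
    refine ⟨fun c => Quotient.liftOn' c ψ₀ fun x y hxy => apply_eq_of_mem_orbit_closure hψ hxy, ?_⟩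
    refine Prod.ext (Subtype.ext (funext fun t => ?_)) (Subtype.ext (funext fun t => ?_))
    · change ψ₀ (L.enter t) = g t
      simp only [ψ₀, L.col_enter, if_true, edge_enter]
    · change ψ₀ (L.chF (L.enter t)) = g' t
      simp [ψ₀, L.col_chF, L.col_enter, edge_chF, edge_enter]

theorem numFaces_eq [Finite F] (hn : 0 < n) : L.numFaces =
    (Module.finrank (ZMod 2) (LinearMap.ker (P.cMap L.black)) + 1) +
      (Module.finrank (ZMod 2) (LinearMap.ker (P.cMap L.blackᶜ)) + 1) := by
  have : Finite L.Face := Quotient.finite _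
  have := Fintype.ofFinite L.Face
  rw [← P.finrank_potentials hn, ← P.finrank_potentials hn, ← Module.finrank_prod,
    ← (LinearEquiv.ofBijective _ L.faceFunctionToPotentials_bijective).finrank_eq,
    Module.finrank_fintype_fun_eq_card, CellularMap.numFaces, Nat.card_eq_fintype_card]

theorem numVertices_eq : L.numVertices = n := by
  have h1 : ∀ x y : F, MulAction.orbitRel (Subgroup.closure {L.chE, L.chF}) F x y →
      L.label x = L.label y := fun x y h => (L.label_eq_iff x y).2 h
  refine (Nat.card_eq_of_bijective (fun c => Quotient.liftOn' c L.label h1)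
    ⟨?_, fun x => ?_⟩).trans (Nat.card_fin n)
  · intro c d
    refine Quotient.inductionOn₂' c d fun x y h => Quotient.sound' ?_
    exact (L.label_eq_iff x y).1 h
  · obtain ⟨t, rfl⟩ := P.seq_surjective x
    exact ⟨Quotient.mk'' (L.enter t), L.label_enter t⟩

theorem numEdges_eq : L.numEdges = 2 * n := by
  have h0 : ∀ s ∈ ({L.chV, L.chF} : Set (Equiv.Perm F)), ∀ x, L.edge (s x) = L.edge x := by
    rintro s (rfl | rfl) x
    · exact L.edge_chV x
    · exact L.edge_chF x
  have hV := fun x => orbitRel_mk_apply (S := {L.chV, L.chF}) (Set.mem_insert _ _) x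
  have hF := fun x => orbitRel_mk_apply (S := {L.chV, L.chF}) (Set.mem_insert_of_mem _ (Set.mem_singleton _)) x
  have h2 : ∀ x, (Quotient.mk'' x : MulAction.orbitRel.Quotient
      (Subgroup.closure {L.chV, L.chF}) F) = Quotient.mk'' (L.enter (L.edge x)) := by
    intro x
    rcases L.onEdge_edge x with (hx | hx) | (hx | hx)
    · rw [← hx]
    · rw [← hV (L.enter _), ← hx]
    · rw [← hx, hF]
    · rw [← hV (L.enter _), ← hx, hF]
  refine (Nat.card_eq_of_bijective (fun c => Quotient.liftOn' c L.edge
    fun x y hxy => apply_eq_of_mem_orbit_closure h0 hxy) ⟨?_, fun t => ?_⟩).trans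
    (Nat.card_fin (2 * n))
  · intro c d
    refine Quotient.inductionOn₂' c d fun x y h => ?_
    have h' : L.edge x = L.edge y := h
    rw [h2 x, h2 y, h']
  · exact ⟨Quotient.mk'' (L.enter t), L.edge_enter t⟩

/-- The rank of `b` is the connectivity of the surface. -/
theorem finrank_range_bMap_black [Finite F] (hn : 0 < n) :
    (Module.finrank (ZMod 2) (LinearMap.range (P.bMap L.black)) : ℤ) = 2 - L.eulerChar := by
  have h1 := P.finrank_range_bMap L.black
  have h2 := L.numFaces_eq hn
  rw [CellularMap.eulerChar, numVertices_eq, numEdges_eq]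
  push_cast
  omega

/-! ### Orientability when all labels are even -/

theorem exists_visit (x : F) : ∃ t, ∀ y, (y = x ∨ y = L.chF x) → L.col y = true →
    y = L.enter t ∨ y = L.opp (L.enter t) := by
  by_cases hx : L.col x = true
  · obtain ⟨t, ht, -⟩ := L.once x hx
    refine ⟨t, ?_⟩
    rintro y (rfl | rfl) hy
    · exact ht
    · rw [L.col_chF, hx] at hy
      exact absurd hy (by simp)
  · obtain ⟨t, ht, -⟩ := L.once (L.chF x) (by simpa [L.col_chF] using hx)
    refine ⟨t, ?_⟩
    rintro y (rfl | rfl) hy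
    · exact absurd hy hx
    · exact ht

/-- Orient a flag by the parity of the position of its half-edge's passage plus its colour. `chF`
changes only the colour; `chV` moves to a neighbouring position; `chE` moves to the other passage,
of opposite parity as every label is even. -/
theorem orientable_of_oddLabels_eq_empty (hO : P.oddLabels = ∅) : L.Orientable := by
  choose visit hvisit using L.exists_visit
  have hv : ∀ x, L.col x = true → ∀ t, x = L.enter t ∨ x = L.opp (L.enter t) → visit x = t :=
    fun x hx t ht => (L.once x hx).unique (hvisit x x (Or.inl rfl) hx) ht
  have hv' : ∀ x, L.col x = true → ∀ t, x = L.enter t ∨ x = L.opp (L.enter t) →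
      visit (L.chF x) = t := fun x hx t ht =>
    (L.once x hx).unique (hvisit (L.chF x) x (Or.inr (L.chF_chF x).symm) hx) ht
  have hF : ∀ x, visit (L.chF x) = visit x := by
    intro x
    by_cases hx : L.col x = true
    · exact hv' x hx _ (hvisit x x (Or.inl rfl) hx)
    · have hx' : L.col (L.chF x) = true := by simpa [L.col_chF] using hx
      exact hv _ hx' _ (hvisit x _ (Or.inr rfl) hx')
  have hrot : ∀ t : Fin (2 * n), (((finRotate (2 * n) t : Fin (2 * n)) : ℕ) : ZMod 2) =
      (t : ℕ) + 1 := by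
    intro t
    rcases (Nat.succ_le_of_lt t.2).eq_or_lt with ht | ht
    -- The wrap-around also changes parity, because the length 2n is even.
    · rw [finRotate_val_of_eq t ht, ← Nat.cast_succ, ht]
      rw [Nat.cast_mul, Nat.cast_zero, CharP.cast_eq_zero (ZMod 2) 2, zero_mul]
    · rw [finRotate_val_of_lt t ht, Nat.cast_succ]
  have htwin : ∀ s t : Fin (2 * n), s ≠ t → P.seq s = P.seq t →
      ((s : ℕ) : ZMod 2) = (t : ℕ) + 1 := by
    have key : ∀ s t : Fin (2 * n), s < t → P.seq s = P.seq t →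
        ((s : ℕ) : ZMod 2) + (t : ℕ) + 1 = 0 := by
      intro s t hst h
      have h1 := mt P.mem_oddLabels.2 (hO ▸ Finset.notMem_empty (P.seq t))
      rw [P.card_interlace_add hst h] at h1
      have h3 : ∀ a : ZMod 2, a ≠ 1 → a = 0 := by decide
      exact h3 _ h1
    have h4 : ∀ a b : ZMod 2, a + b + 1 = 0 → a = b + 1 ∧ b = a + 1 := by decide
    intro s t hst h
    rcases lt_or_gt_of_ne hst with h1 | h1
    · exact (h4 _ _ (key s t h1 h)).1
    · exact (h4 _ _ (key t s h1 h.symm)).2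
  have hE : ∀ x, L.col x = true →
      (((visit (L.chE x) : Fin (2 * n)) : ℕ) : ZMod 2) = ((visit x : Fin (2 * n)) : ℕ) + 1 := by
    intro x hx
    obtain ⟨s, hs, -⟩ := L.once x hx
    obtain ⟨t, hst, h⟩ := exists_twin (P := P) s
    have h1 := L.chE_enter hst h
    rw [hv x hx s hs, hv (L.chE x) (by rw [L.col_chE, hx]) t, htwin t s hst.symm h.symm]
    rcases hs with rfl | rfl
    · exact h1
    · rw [← opp_chE]
      rcases h1 with h1 | h1 <;> rw [h1]
      · exact Or.inr rfl
      · exact Or.inl (L.opp_opp _)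
  have hV : ∀ x, L.col x = true →
      (((visit (L.chV x) : Fin (2 * n)) : ℕ) : ZMod 2) = ((visit x : Fin (2 * n)) : ℕ) + 1 := by
    intro x hx
    have hx' : L.col (L.chV x) = true := by rw [L.col_chV, hx]
    obtain ⟨s, hs, -⟩ := L.once x hx
    rw [hv x hx s hs]
    rcases hs with rfl | rfl
    · obtain ⟨r, rfl⟩ := (finRotate (2 * n)).surjective s
      have h5 : ∀ a : ZMod 2, a = a + 1 + 1 := by decide
      rw [hv _ hx' r (Or.inr (L.chV_enter r)), hrot, ← h5]
    · rw [hv _ hx' (finRotate _ s) (Or.inl (L.enter_next s).symm), hrot]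
  have hopp : ∀ x, L.col x = true → visit (L.opp x) = visit x := by
    intro x hx
    refine hv _ (by rw [col_opp, hx]) _ ?_
    rcases hvisit x x (Or.inl rfl) hx with h | h
    · exact Or.inr (congrArg _ h)
    · exact Or.inl ((congrArg _ h).trans (L.opp_opp _))
  have hE' : ∀ x,
      (((visit (L.chE x) : Fin (2 * n)) : ℕ) : ZMod 2) = ((visit x : Fin (2 * n)) : ℕ) + 1 := by
    intro x
    by_cases hx : L.col x = true
    · exact hE x hx
    · have hx' : L.col (L.chF x) = true := by simpa [L.col_chF] using hx
      rw [← hF x, ← hopp _ hx', ← hE _ (by rw [col_opp, hx']), ← hF (L.chE (L.opp _)), ← chE_chF,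
        L.chF_chF]
  have hV' : ∀ x,
      (((visit (L.chV x) : Fin (2 * n)) : ℕ) : ZMod 2) = ((visit x : Fin (2 * n)) : ℕ) + 1 := by
    intro x
    by_cases hx : L.col x = true
    · exact hV x hx
    · have hx' : L.col (L.chF x) = true := by simpa [L.col_chF] using hx
      rw [← hF x, ← hV _ hx', L.chV_chF, hF]
  have h1 : ∀ a : ZMod 2, decide (a + 1 = 1) = !decide (a = 1) := by decide
  have h2 : ∀ (a : ZMod 2) (b : Bool), decide (a + (if (!b) = true then 1 else 0) = 1) =
      !decide (a + (if b = true then 1 else 0) = 1) := by decide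
  refine ⟨fun x => decide ((((visit x : Fin (2 * n)) : ℕ) : ZMod 2) +
    (if L.col x = true then 1 else 0) = 1), fun x => ⟨?_, ?_, ?_⟩⟩
  · dsimp only
    rw [L.col_chV, hV', add_right_comm, h1]
  · dsimp only
    rw [L.col_chE, hE', add_right_comm, h1]
  · dsimp only
    rw [L.col_chF, hF, h2]

theorem pos_of_eulerChar_or (h : L.eulerChar ≠ 0 ∨ ¬ L.Orientable) : 0 < n := by
  rcases Nat.eq_zero_or_pos n with rfl | hn
  -- The encoding admits an empty set of flags; it is orientable with Euler characteristic 0, hence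
  -- none of the three surfaces.
  · have : IsEmpty F := ⟨fun x => (L.label x).elim0⟩
    exfalso
    rcases h with h | h
    · refine h ?_
      simp [CellularMap.eulerChar, CellularMap.numVertices, CellularMap.numEdges,
        CellularMap.numFaces]
    · exact h ⟨fun x => isEmptyElim x, fun x => isEmptyElim x⟩
  · exact hn

end ColouredLacet

theorem mainTheorem3 {n : ℕ} (P : GaussCode n) {F : Type*} [Finite F] (L : ColouredLacet P F)
    (hS : L.OnSphere ∨ L.OnProjectivePlane ∨ L.OnKleinBottle) :
    (∃ O₀ O₁ E₀ E₁ : Finset (Fin n), P.IsBPartition L.black O₀ O₁ E₀ E₁ ∧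
      (L.OnKleinBottle → O₀.Nonempty ∧ ¬ (O₁ = ∅ ∧ E₁ = ∅))) ∧
    (∀ O₀ O₁ E₀ E₁ : Finset (Fin n), P.IsBPartition L.black O₀ O₁ E₀ E₁ →
      P.IsSolution (deltaOf O₁ E₁) L.gamma) := by
  refine ⟨?_, fun O₀ O₁ E₀ E₁ h => h.isSolution P L.gamma rfl⟩
  have hn : 0 < n := by
    apply L.pos_of_eulerChar_or
    rcases hS with h | h | h
    · exact Or.inl (by rw [h.2]; norm_num)
    · exact Or.inr h.1
    · exact Or.inr h.1
  have hr := L.finrank_range_bMap_black hn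
  by_cases hK : L.OnKleinBottle
  · rw [hK.2] at hr
    obtain ⟨O₀, O₁, E₀, E₁, h, h'⟩ := P.isBPartition_of_finrank_range_eq_two L.black (by omega)
      (Finset.nonempty_iff_ne_empty.2 fun hO => hK.1 (L.orientable_of_oddLabels_eq_empty hO))
    exact ⟨O₀, O₁, E₀, E₁, h, fun _ => h'⟩
  -- The rank is 0 on the sphere and 1 on the projective plane.
  · obtain ⟨O₀, O₁, E₀, E₁, h⟩ := P.isBPartition_of_finrank_range_le_one L.black (by
      rcases hS with h | h | h
      · rw [h.2] at hr; omega
      · rw [h.2] at hr; omega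
      · exact absurd h hK)
    exact ⟨O₀, O₁, E₀, E₁, h, fun h => absurd h hK⟩
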